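/- Let $n\ge 1$ be an integer and let $A_1,A_2,\dots,A_{2n}$ be strictly positive (i.e. positive and invertible) bounded linear operators on a complex Hilbert space; $\ge$ denotes the usual operator order, $S\ge T\iff (Sx,x)\ge (Tx,x)$ for all $x$, on selfadjoint operators. For real numbers $t_1,\dots,t_n$ and $p_1,\dots,p_{2n}$, define $\psi[2]=(p_1-t_1)p_2+t_1$ and $$\psi[2m+2]=\bigl(\psi[2m]\,p_{2m+1}-t_{m+1}\bigr)p_{2m+2}+t_{m+1}\qquad(1\le m<n),$$ and for strictly positive operators $B_1,\dots,B_{2n}$ define $F_1=\bigl(B_2^{-t_1/2}B_1^{p_1}B_2^{-t_1/2}\bigr)^{p_2}$ and $$F_{m+1}=\Bigl[B_{2m+2}^{-t_{m+1}/2}\bigl\{B_{2m+1}^{t_m/2}\,F_m\,B_{2m+1}^{t_m/2}\bigr\}^{p_{2m+1}}B_{2m+2}^{-t_{m+1}/2}\Bigr]^{p_{2m+2}}\qquad(1\le m<n).$$ Write $F(B_1,\dots,B_{2n})=F_n$. Then the following two assertions are equivalent. (I) $A_{2n}\ge A_{2n-1}\ge\cdots\ge A_2\ge A_1$. (II) For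 all $t_1,\dots,t_n\in[0,1]$, all $p_1,\dots,p_{2n}\ge 1$ and all $r\ge t_n$, the following $2n-1$ inequalities hold: for $k=1,\dots,n$, $$A_{2n}^{\,r-t_n}\ \ge\ \Bigl\{A_{2n}^{r/2}\;F(B_1,\dots,B_{2n})\;A_{2n}^{r/2}\Bigr\}^{\frac{r-t_n}{\psi[2n]-t_n+r}},\qquad B_i=A_{\min(k+i-1,\,2n)};$$ for $k=n+1,\dots,2n-1$, $$A_{1}^{\,r-t_n}\ \le\ \Bigl\{A_{1}^{r/2}\;F(B_1,\dots,B_{2n})\;A_{1}^{r/2}\Bigr\}^{\frac{r-t_n}{\psi[2n]-t_n+r}},\qquad B_i=A_{\max(k+2-i,\,1)}.$$ -/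

import Mathlib

noncomputable section

variable {H : Type*} [NormedAddCommGroup H] [InnerProductSpace ℂ H] [CompleteSpace H]

/-- The numbers `ψ[2n]` attached to `t 1, …, t n` and `p 1, …, p (2n)`:
`ψ[2] = (p₁ - t₁) p₂ + t₁` and
`ψ[2(m+1)] = (ψ[2m] p_{2m+1} - t_{m+1}) p_{2m+2} + t_{m+1}`.
The argument is `n` (so `furutaPsi t p n` is `ψ[2n]`); the value at `n = 0` is not used. -/
def furutaPsi (t p : ℕ → ℝ) : ℕ → ℝ
  | 0 => 1
  | 1 => (p 1 - t 1) * p 2 + t 1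
  | m + 2 => (furutaPsi t p (m + 1) * p (2 * m + 3) - t (m + 2)) * p (2 * m + 4) + t (m + 2)

/-- The nested bracket built on operators `B 1, B 2, …, B (2n)`, without the outermost factors:
`[B₂ₙ^(-tₙ/2) {B₂ₙ₋₁^(tₙ₋₁/2) ⋯ {B₃^(t₁/2) (B₂^(-t₁/2) B₁^p₁ B₂^(-t₁/2))^p₂ B₃^(t₁/2)}^p₃ ⋯
B₂ₙ₋₁^(tₙ₋₁/2)}^p₂ₙ₋₁ B₂ₙ^(-tₙ/2)]^p₂ₙ`.
Real powers are those of the continuous functional calculus. The last argument is `n`; the value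
at `n = 0` is not used. -/
def furutaNest (B : ℕ → H →L[ℂ] H) (t p : ℕ → ℝ) : ℕ → H →L[ℂ] H
  | 0 => 1
  | 1 => (B 2 ^ (-t 1 / 2) * B 1 ^ p 1 * B 2 ^ (-t 1 / 2)) ^ p 2
  | m + 2 =>
      (B (2 * m + 4) ^ (-t (m + 2) / 2) *
        (B (2 * m + 3) ^ (t (m + 1) / 2) * furutaNest B t p (m + 1) *
          B (2 * m + 3) ^ (t (m + 1) / 2)) ^ p (2 * m + 3) *
        B (2 * m + 4) ^ (-t (m + 2) / 2)) ^ p (2 * m + 4)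

/-- The full Furuta-type expression with outermost operator `C`:
`{C^(r/2) [nested bracket] C^(r/2)}^((r - tₙ) / (ψ[2n] - tₙ + r))`. -/
def furutaExpr (C : H →L[ℂ] H) (B : ℕ → H →L[ℂ] H) (t p : ℕ → ℝ) (r : ℝ) (n : ℕ) : H →L[ℂ] H :=
  (C ^ (r / 2) * furutaNest B t p n * C ^ (r / 2)) ^ ((r - t n) / (furutaPsi t p n - t n + r))

end

open CFC

/-! ### Real powers, operator monotonicity and congruence. -/

section
variable {𝒜 : Type*} [CStarAlgebra 𝒜] [PartialOrder 𝒜] [StarOrderedRing 𝒜]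

/-! (I) ⇒ (II): along an increasing chain `B` the invariant is `(b^(t/2) F_m b^(t/2))^(1/ψ[2m]) ≤ b`
with `b = B_{2m}`, `t = t_m`. It survives enlarging `b` (`rpow_conj_rpow_le_of_le`), and
`grand_furuta` carries it to level `m + 1`; at level `n`, `furuta_chaotic` turns it into the
required inequality. For `k > n` the chain decreases; inversion reverses the order and commutes with
the bracket, so the inverses form an increasing chain.

(II) ⇒ (I): take `t₁ = 1`, `p₂ = s`, every other `t` equal to 0 and every other `p` equal to 1. With
`X = B₂^(-1/2) B₁ B₂^(-1/2)`, a fixed congruence of `X^s` stays bounded for all `s ≥ 1`, so `X ≤ 1`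
(`le_one_of_rpow_conj_le`), that is `B₁ ≤ B₂`. The `k`-th inequality thus compares `A k` with `A (k
+ 1)`. -/

theorem IsStrictlyPositive.rpow_rpow {a : 𝒜} (ha : IsStrictlyPositive a) (x y : ℝ) :
    (a ^ x) ^ y = a ^ (x * y) := by
  rcases eq_or_ne x 0 with rfl | hx
  · simp [rpow_zero a ha.nonneg]
  · exact CFC.rpow_rpow a x y hx ha

theorem IsStrictlyPositive.rpow_mul_rpow {a : 𝒜} (ha : IsStrictlyPositive a) (x y : ℝ) :
    a ^ x * a ^ y = a ^ (x + y) := (rpow_add ha.isUnit).symm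

theorem IsStrictlyPositive.rpow_mul_rpow_mul_rpow {a : 𝒜} (ha : IsStrictlyPositive a) (x y : ℝ) :
    a ^ (x / 2) * a ^ y * a ^ (x / 2) = a ^ (x + y) := by
  rw [ha.rpow_mul_rpow, ha.rpow_mul_rpow]
  congr 1
  ring

/-- The form `a ^ (x / 2) * b * a ^ (x / 2)` composes additively in `x`. -/
theorem IsStrictlyPositive.rpow_conj_conj {a : 𝒜} (ha : IsStrictlyPositive a) (b : 𝒜) (x y : ℝ) :
    a ^ (x / 2) * (a ^ (y / 2) * b * a ^ (y / 2)) * a ^ (x / 2)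
      = a ^ ((x + y) / 2) * b * a ^ ((x + y) / 2) := by
  have h1 : a ^ ((x + y) / 2) = a ^ (x / 2) * a ^ (y / 2) := by
    rw [ha.rpow_mul_rpow]; congr 1; ring
  have h2 : a ^ ((x + y) / 2) = a ^ (y / 2) * a ^ (x / 2) := by
    rw [ha.rpow_mul_rpow]; congr 1; ring
  nth_rw 1 [h1]
  rw [h2]
  simp only [mul_assoc]

theorem IsStrictlyPositive.rpow_zero_conj {a : 𝒜} (ha : IsStrictlyPositive a) (b : 𝒜) {x : ℝ}
    (hx : x = 0) : a ^ x * b * a ^ x = b := by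
  rw [hx, rpow_zero a ha.nonneg, one_mul, mul_one]

theorem rpow_conj_le_rpow_conj {b c : 𝒜} (hbc : b ≤ c) (a : 𝒜) (x : ℝ) :
    a ^ x * b * a ^ x ≤ a ^ x * c * a ^ x :=
  conjugate_le_conjugate_of_nonneg hbc rpow_nonneg

theorem IsStrictlyPositive.rpow_conj_le_iff {a b c : 𝒜} (ha : IsStrictlyPositive a) {x : ℝ} :
    a ^ (x / 2) * b * a ^ (x / 2) ≤ c ↔ b ≤ a ^ (-x / 2) * c * a ^ (-x / 2) := by
  constructor <;> intro h
  · have h' := rpow_conj_le_rpow_conj h a (-x / 2)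
    rwa [ha.rpow_conj_conj, ha.rpow_zero_conj b (by ring)] at h'
  · have h' := rpow_conj_le_rpow_conj h a (x / 2)
    rwa [ha.rpow_conj_conj, ha.rpow_zero_conj c (by ring)] at h'

theorem IsStrictlyPositive.rpow_conj {a b : 𝒜} (ha : IsStrictlyPositive a)
    (hb : IsStrictlyPositive b) (x : ℝ) : IsStrictlyPositive (a ^ x * b * a ^ x) := by
  have h := (ha.rpow a x).isUnit.isStrictlyPositive_star_right_conjugate_iff (a := b)
  rw [(rpow_nonneg (a := a) (y := x)).isSelfAdjoint.star_eq] at h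
  exact h.2 hb

/-- Powers of negative exponent `s ∈ [-1, 0]` are operator antitone. -/
theorem rpow_le_rpow_of_nonpos {a b : 𝒜} (ha : IsStrictlyPositive a) (hab : a ≤ b) {s : ℝ}
    (h1 : -1 ≤ s) (h0 : s ≤ 0) : b ^ s ≤ a ^ s := by
  have hb := ha.of_le hab
  have h := CFC.rpow_le_rpow (p := -s) ⟨by linarith, by linarith⟩ hab
  have h' := CStarAlgebra.rpow_neg_one_le_rpow_neg_one h (ha.rpow a (-s))
  rw [ha.rpow_rpow, hb.rpow_rpow] at h'
  simpa using h'

theorem Unitary.rpow_conj (u : unitary 𝒜) {a : 𝒜} (ha : IsStrictlyPositive a) (s : ℝ) :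
    ((u : 𝒜) * a * star (u : 𝒜)) ^ s = u * a ^ s * star (u : 𝒜) := by
  have hsa : IsStrictlyPositive ((u : 𝒜) * a * star (u : 𝒜)) :=
    (Unitary.toUnits u).isUnit.isStrictlyPositive_star_right_conjugate_iff.2 ha
  have hc : ContinuousOn (fun x : ℝ => x ^ s) (spectrum ℝ a) :=
    continuousOn_id.rpow_const fun x hx => Or.inl (ha.spectrum_pos (𝕜 := ℝ) hx).ne'
  have hφ : Continuous (Unitary.conjStarAlgAut ℂ 𝒜 u) := by
    have : (Unitary.conjStarAlgAut ℂ 𝒜 u : 𝒜 → 𝒜) = fun x => u * x * star (u : 𝒜) := by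
      ext x; simp
    rw [this]
    fun_prop
  have h := StarAlgHomClass.map_cfc (R := ℝ) (S := ℂ) (Unitary.conjStarAlgAut ℂ 𝒜 u)
    (fun x : ℝ => x ^ s) a (hf := hc) (hφ := hφ) (ha := ha.nonneg.isSelfAdjoint)
    (hφa := by simpa using hsa.nonneg.isSelfAdjoint)
  rw [rpow_eq_cfc_real ha.nonneg, rpow_eq_cfc_real hsa.nonneg]
  simpa using h.symm

/-- Moving a power through `T * star T` for an invertible `T`. -/
theorem IsUnit.rpow_mul_star_self {T : 𝒜} (hT : IsUnit T) (s : ℝ) :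
    (T * star T) ^ s = T * (star T * T) ^ (s - 1) * star T := by
  have hS : IsStrictlyPositive (star T * T) :=
    CStarAlgebra.isStrictlyPositive_iff_eq_star_mul_self.2 ⟨T, hT, rfl⟩
  set S := star T * T with hSdef
  have hR : star (S ^ (-(1 / 2) : ℝ)) = S ^ (-(1 / 2) : ℝ) :=
    (rpow_nonneg (a := S)).isSelfAdjoint.star_eq
  have hconj (b : ℝ) : S ^ (-(1 / 2) : ℝ) * S ^ b * S ^ (-(1 / 2) : ℝ) = S ^ (b - 1) := by
    rw [hS.rpow_mul_rpow, hS.rpow_mul_rpow]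
    congr 1
    ring
  have h1 : S ^ (-(1 / 2) : ℝ) * S * S ^ (-(1 / 2) : ℝ) = 1 :=
    conjugate_rpow_neg_one_half S hS
  -- The unitary polar factor of `T`, for which `T * star T = U * S * star U`.
  set U := T * S ^ (-(1 / 2) : ℝ) with hU
  have hUU : star U * U = 1 := by
    rw [hU, star_mul, hR, ← h1, hSdef]
    simp only [mul_assoc]
  have hUunit : IsUnit U := hT.mul (hS.rpow S _).isUnit
  have hUU' : U * star U = 1 := by
    obtain ⟨V, hV⟩ := hUunit
    have : star U = ↑V⁻¹ := (V.inv_eq_of_mul_eq_one_left (by rw [hV, hUU])).symm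
    rw [this, ← hV, V.mul_inv]
  have h := Unitary.rpow_conj ⟨U, Unitary.mem_iff.2 ⟨hUU, hUU'⟩⟩ hS s
  have hc (X : 𝒜) : U * X * star U
      = T * (S ^ (-(1 / 2) : ℝ) * X * S ^ (-(1 / 2) : ℝ)) * star T := by
    rw [hU, star_mul, hR]
    simp only [mul_assoc]
  simp only [hc, h1, hconj, mul_one] at h
  exact h

/-- Furuta's lemma, from `T = a^(x/2) b^(y/2)`. It trades the exponent `s` for `s - 1`, often
bringing it within reach of Löwner–Heinz. -/
theorem rpow_conj_rpow {a b : 𝒜} (ha : IsStrictlyPositive a) (hb : IsStrictlyPositive b)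
    (x y s : ℝ) :
    (a ^ (x / 2) * b ^ y * a ^ (x / 2)) ^ s =
      a ^ (x / 2) * (b ^ (y / 2) * (b ^ (y / 2) * a ^ x * b ^ (y / 2)) ^ (s - 1) * b ^ (y / 2))
        * a ^ (x / 2) := by
  have h := ((ha.rpow a (x / 2)).isUnit.mul (hb.rpow b (y / 2)).isUnit).rpow_mul_star_self s
  have sa : star (a ^ (x / 2)) = a ^ (x / 2) := (rpow_nonneg (a := a)).isSelfAdjoint.star_eq
  have sb : star (b ^ (y / 2)) = b ^ (y / 2) := (rpow_nonneg (a := b)).isSelfAdjoint.star_eq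
  have ha2 : a ^ x = a ^ (x / 2) * a ^ (x / 2) := by rw [ha.rpow_mul_rpow]; simp
  have hb2 : b ^ y = b ^ (y / 2) * b ^ (y / 2) := by rw [hb.rpow_mul_rpow]; simp
  rw [ha2, hb2]
  simpa only [star_mul, sa, sb, mul_assoc] using h

/-- Löwner–Heinz followed by taking a root. -/
theorem rpow_le_of_le_rpow {a b : 𝒜} (hb : IsStrictlyPositive b) {q : ℝ} (hq : 1 ≤ q)
    (h : a ≤ b ^ q) : a ^ (1 / q) ≤ b := by
  have hq0 : 0 < q := by linarith
  have := CFC.rpow_le_rpow (p := 1 / q) ⟨by positivity, (div_le_one hq0).2 hq⟩ h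
  rwa [hb.rpow_rpow, mul_one_div_cancel hq0.ne', rpow_one b hb.nonneg] at this

/-! ### The grand Furuta and Furuta inequalities. -/

/-- By `rpow_conj_rpow` the outer powers of `a` cancel, leaving `b^(p/2) a^(-t) b^(p/2) ≤ b^(p-t)`
to be raised to `s - 1 ∈ [0, 1]`. -/
theorem grand_furuta_of_le_two {a b : 𝒜} (hb : IsStrictlyPositive b) (hba : b ≤ a) {t p s : ℝ}
    (ht0 : 0 ≤ t) (ht1 : t ≤ 1) (hp : 1 ≤ p) (hs1 : 1 ≤ s) (hs2 : s ≤ 2) :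
    (a ^ (t / 2) * (a ^ (-t / 2) * b ^ p * a ^ (-t / 2)) ^ s * a ^ (t / 2)) ^
      (1 / ((p - t) * s + t)) ≤ b := by
  have ha := hb.of_le hba
  apply rpow_le_of_le_rpow hb (by nlinarith)
  rw [rpow_conj_rpow ha hb, ha.rpow_conj_conj, ha.rpow_zero_conj _ (by ring)]
  have h1 := rpow_conj_le_rpow_conj
    (rpow_le_rpow_of_nonpos hb hba (s := -t) (by linarith) (by linarith)) b (p / 2)
  rw [hb.rpow_mul_rpow_mul_rpow] at h1
  have h2 := CFC.rpow_le_rpow (p := s - 1) ⟨by linarith, by linarith⟩ h1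
  have h3 := rpow_conj_le_rpow_conj h2 b (p / 2)
  rw [hb.rpow_rpow, hb.rpow_mul_rpow_mul_rpow] at h3
  convert h3 using 2
  ring

/-- The case `r = t` of the grand Furuta inequality, in the stronger form with `b` as bound. -/
theorem grand_furuta {a b : 𝒜} (hb : IsStrictlyPositive b) (hba : b ≤ a) {t p s : ℝ}
    (ht0 : 0 ≤ t) (ht1 : t ≤ 1) (hp : 1 ≤ p) (hs : 1 ≤ s) :
    (a ^ (t / 2) * (a ^ (-t / 2) * b ^ p * a ^ (-t / 2)) ^ s * a ^ (t / 2)) ^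
      (1 / ((p - t) * s + t)) ≤ b := by
  obtain ⟨N, hN⟩ := pow_unbounded_of_one_lt s (one_lt_two (α := ℝ))
  induction N generalizing s p b with
  | zero => rw [pow_zero] at hN; linarith
  | succ N ih =>
    rcases le_or_gt s 2 with hs2 | hs2
    · exact grand_furuta_of_le_two hb hba ht0 ht1 hp hs hs2
    · have ha := hb.of_le hba
      -- The case `s = 2` replaces `b` by a smaller operator and `p` by `q`; the new inner bracket
      -- is `X^2`, so the exponent left is `s / 2`.
      have h1 := grand_furuta_of_le_two hb hba ht0 ht1 hp one_le_two le_rfl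
      set q := (p - t) * 2 + t with hq
      have hq1 : 1 ≤ q := by linarith
      set X := a ^ (-t / 2) * b ^ p * a ^ (-t / 2) with hX
      have hXpos : IsStrictlyPositive X := ha.rpow_conj (hb.rpow b p) _
      have hEpos := ha.rpow_conj (hXpos.rpow X 2) (t / 2)
      have h2 := ih (hEpos.rpow _ (1 / q)) (h1.trans hba) hq1 (s := s / 2) (by linarith)
        (by rw [pow_succ] at hN; linarith)
      rw [hEpos.rpow_rpow, one_div_mul_cancel (by linarith : q ≠ 0), rpow_one _ hEpos.nonneg,
        ha.rpow_conj_conj, ha.rpow_zero_conj (X ^ (2 : ℝ)) (by ring), hXpos.rpow_rpow,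
        mul_div_cancel₀ s two_ne_zero,
        show (q - t) * (s / 2) + t = (p - t) * s + t by rw [hq]; ring] at h2
      exact h2.trans h1

theorem furuta_of_le_one {a b : 𝒜} (hb : IsStrictlyPositive b) (hba : b ≤ a) {r p : ℝ}
    (hr0 : 0 ≤ r) (hr1 : r ≤ 1) (hp : 1 ≤ p) :
    (a ^ (r / 2) * b ^ p * a ^ (r / 2)) ^ ((1 + r) / (p + r)) ≤ a ^ (1 + r) := by
  have ha := hb.of_le hba
  have hpr : 0 < p + r := by linarith
  have hexp : (1 + r) / (p + r) - 1 = (1 - p) / (p + r) := by field_simp; ring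
  have h1 := rpow_conj_le_rpow_conj
    (CFC.rpow_le_rpow (p := r) ⟨hr0, hr1⟩ hba) b (p / 2)
  rw [hb.rpow_mul_rpow_mul_rpow] at h1
  have h2 := rpow_conj_le_rpow_conj (rpow_le_rpow_of_nonpos (hb.rpow b _) h1
    (s := (1 + r) / (p + r) - 1) (by rw [hexp, le_div_iff₀ hpr]; linarith)
    (by rw [hexp]; exact div_nonpos_of_nonpos_of_nonneg (by linarith) hpr.le)) b (p / 2)
  rw [hb.rpow_rpow, hb.rpow_mul_rpow_mul_rpow,
    show p + (p + r) * ((1 + r) / (p + r) - 1) = 1 by field_simp; ring,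
    rpow_one b hb.nonneg] at h2
  rw [rpow_conj_rpow ha hb]
  refine (rpow_conj_le_rpow_conj (h2.trans hba) a (r / 2)).trans_eq ?_
  nth_rw 2 [← rpow_one a ha.nonneg]
  rw [ha.rpow_mul_rpow_mul_rpow, add_comm]

/-- The Furuta inequality. -/
theorem furuta {a b : 𝒜} (hb : IsStrictlyPositive b) (hba : b ≤ a) {r p : ℝ}
    (hr : 0 ≤ r) (hp : 1 ≤ p) :
    (a ^ (r / 2) * b ^ p * a ^ (r / 2)) ^ ((1 + r) / (p + r)) ≤ a ^ (1 + r) := by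
  obtain ⟨N, hN⟩ := pow_unbounded_of_one_lt (1 + r) (one_lt_two (α := ℝ))
  induction N generalizing r with
  | zero => rw [pow_zero] at hN; linarith
  | succ N ih =>
    rcases le_or_gt r 1 with hr1 | hr1
    · exact furuta_of_le_one hb hba hr hr1 hp
    · have ha := hb.of_le hba
      -- The inequality at `u` gives a pair bounded by `a^(1+u)`; the case `r = 1` for that pair
      -- reaches `u + (1 + u) = r`.
      obtain ⟨u, hu⟩ : ∃ u, u = (r - 1) / 2 := ⟨_, rfl⟩
      obtain rfl : r = 2 * u + 1 := by rw [hu]; ring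
      have hu0 : 0 < u := by linarith
      have h1 := ih hu0.le (by rw [pow_succ] at hN; linarith)
      have hXpos := ha.rpow_conj (hb.rpow b p) (u / 2)
      have h2 := furuta_of_le_one (hXpos.rpow _ _) h1 zero_le_one le_rfl
        (p := (p + u) / (1 + u)) (by rw [le_div_iff₀ (by linarith)]; linarith)
      rw [hXpos.rpow_rpow, show (1 + u) / (p + u) * ((p + u) / (1 + u)) = 1 by field_simp,
        rpow_one _ hXpos.nonneg, ha.rpow_rpow, ha.rpow_rpow,
        show (1 + u) * (1 / 2) = (1 + u) / 2 by ring, ha.rpow_conj_conj] at h2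
      convert h2 using 2
      · congr 1 <;> [congr 2; congr 1] <;> ring
      · field_simp
        ring
      · ring

/-- The Furuta inequality with the exponent of the chaotic order. -/
theorem furuta_chaotic {a b : 𝒜} (hb : IsStrictlyPositive b) (hba : b ≤ a) {r p : ℝ}
    (hr : 0 ≤ r) (hp : 1 ≤ p) :
    (a ^ (r / 2) * b ^ p * a ^ (r / 2)) ^ (r / (p + r)) ≤ a ^ r := by
  have ha := hb.of_le hba
  have h := CFC.rpow_le_rpow (p := r / (1 + r))
    ⟨by positivity, (div_le_one (by linarith)).2 (by linarith)⟩ (furuta hb hba hr hp)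
  rwa [(ha.rpow_conj (hb.rpow b p) (r / 2)).rpow_rpow, ha.rpow_rpow,
    show (1 + r) / (p + r) * (r / (1 + r)) = r / (p + r) by field_simp,
    show (1 + r) * (r / (1 + r)) = r by field_simp] at h

/-- Monotonicity in `a` of the relation `(a ^ (t / 2) * f * a ^ (t / 2)) ^ (1 / q) ≤ a`. -/
theorem rpow_conj_rpow_le_of_le {a b f : 𝒜} (hb : IsStrictlyPositive b) (hba : b ≤ a)
    (hf : IsStrictlyPositive f) {t q : ℝ} (ht0 : 0 ≤ t) (ht1 : t ≤ 1) (hq : 1 ≤ q)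
    (h : (b ^ (t / 2) * f * b ^ (t / 2)) ^ (1 / q) ≤ b) :
    (a ^ (t / 2) * f * a ^ (t / 2)) ^ (1 / q) ≤ a := by
  have ha := hb.of_le hba
  have hq0 : 0 < q := by linarith
  -- On the right of this equivalence the left side is antitone in `c` and the right side monotone.
  have key {c : 𝒜} (hc : IsStrictlyPositive c) :
      (c ^ (t / 2) * f * c ^ (t / 2)) ^ (1 / q) ≤ c ↔
        (f ^ (1 / 2 : ℝ) * c ^ t * f ^ (1 / 2 : ℝ)) ^ (1 / q - 1) ≤
          f ^ (-1 / 2 : ℝ) * c ^ (1 - t) * f ^ (-1 / 2 : ℝ) := by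
    have e := rpow_conj_rpow hc hf t 1 (1 / q)
    have e' := hc.rpow_mul_rpow_mul_rpow (-t) 1
    rw [rpow_one f hf.nonneg] at e
    rw [rpow_one c hc.nonneg, neg_add_eq_sub] at e'
    rw [e, hc.rpow_conj_le_iff, hf.rpow_conj_le_iff, e']
  rw [key ha]
  refine (rpow_le_rpow_of_nonpos (hf.rpow_conj (hb.rpow b t) (1 / 2)) (rpow_conj_le_rpow_conj
    (CFC.rpow_le_rpow (p := t) ⟨ht0, ht1⟩ hba) f (1 / 2)) ?_ ?_).trans
    (((key hb).1 h).trans ?_)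
  · have : 0 < 1 / q := by positivity
    linarith
  · rw [sub_nonpos]
    exact (div_le_one hq0).2 hq
  · exact rpow_conj_le_rpow_conj (CFC.rpow_le_rpow ⟨by linarith, by linarith⟩ hba) f _

/-! ### Inversion, and boundedness of powers. -/

theorem rpow_neg_one_le_rpow_neg_one_iff {a b : 𝒜} (ha : IsStrictlyPositive a)
    (hb : IsStrictlyPositive b) : b ^ (-1 : ℝ) ≤ a ^ (-1 : ℝ) ↔ a ≤ b := by
  refine ⟨fun h => ?_, fun h => CStarAlgebra.rpow_neg_one_le_rpow_neg_one h ha⟩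
  have h' := CStarAlgebra.rpow_neg_one_le_rpow_neg_one h (hb.rpow b _)
  rwa [ha.rpow_rpow, hb.rpow_rpow, neg_one_mul, neg_neg, rpow_one a ha.nonneg,
    rpow_one b hb.nonneg] at h'

theorem rpow_conj_rpow_neg_one {a b : 𝒜} (ha : IsStrictlyPositive a)
    (hb : IsStrictlyPositive b) (x : ℝ) :
    (a ^ x * b * a ^ x) ^ (-1 : ℝ) =
      (a ^ (-1 : ℝ)) ^ x * b ^ (-1 : ℝ) * (a ^ (-1 : ℝ)) ^ x := by
  have hc := ha.rpow_conj hb x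
  have h1 : (a ^ x * b * a ^ x) ^ (-1 : ℝ) * (a ^ x * b * a ^ x) = 1 := by
    have := rpow_neg_mul_rpow (a := a ^ x * b * a ^ x) 1 hc
    rwa [rpow_one _ hc.nonneg] at this
  refine left_inv_eq_right_inv h1 ?_
  have hb' : b * b ^ (-1 : ℝ) = 1 := by
    have := rpow_mul_rpow_neg (a := b) 1 hb
    rwa [rpow_one _ hb.nonneg] at this
  have ha' : a ^ x * a ^ (-x) = 1 := rpow_mul_rpow_neg x ha
  rw [ha.rpow_rpow, neg_one_mul]
  calc _ = a ^ x * (b * ((a ^ x * a ^ (-x)) * b ^ (-1 : ℝ))) * a ^ (-x) := by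
        simp only [mul_assoc]
    _ = 1 := by rw [ha', one_mul, hb', mul_one, ha']

theorem IsStrictlyPositive.rpow_comm {a : 𝒜} (ha : IsStrictlyPositive a) (x y : ℝ) :
    (a ^ x) ^ y = (a ^ y) ^ x := by
  rw [ha.rpow_rpow, ha.rpow_rpow, mul_comm]

/-- If all powers `X ^ s`, `s ≥ 1`, are bounded after a fixed congruence, then `X ≤ 1`. -/
theorem le_one_of_rpow_conj_le {X T C : 𝒜} (hX : 0 ≤ X) (hT : IsUnit T)
    (h : ∀ s : ℝ, 1 ≤ s → (T * X ^ s * star T) ^ (1 / 2 : ℝ) ≤ C) : X ≤ 1 := by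
  obtain ⟨V, rfl⟩ := hT
  rw [← CStarAlgebra.norm_le_one_iff_of_nonneg X hX]
  by_contra! hlt
  -- Exponents `2^k` suffice: there the C⋆-norm of a selfadjoint power is the power of the norm.
  have hbound (k : ℕ) : ‖X‖ ^ 2 ^ k ≤ ‖(↑V⁻¹ : 𝒜)‖ * (‖C‖ * ‖C‖) * ‖star (↑V⁻¹ : 𝒜)‖ := by
    have h1 : (1 : ℝ) ≤ ((2 ^ k : ℕ) : ℝ) := by exact_mod_cast Nat.one_le_two_pow
    have h2 := h _ h1
    rw [rpow_natCast X _ hX] at h2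
    set P := (V : 𝒜) * X ^ 2 ^ k * star (V : 𝒜) with hP
    have hP0 : 0 ≤ P := star_right_conjugate_nonneg (CStarAlgebra.pow_nonneg hX _) _
    have h3 : ‖P ^ (1 / 2 : ℝ)‖ ≤ ‖C‖ :=
      CStarAlgebra.norm_le_norm_of_nonneg_of_le rpow_nonneg h2
    have h4 : P ^ (1 / 2 : ℝ) * P ^ (1 / 2 : ℝ) = P := by
      rw [← sqrt_eq_rpow, sqrt_mul_sqrt_self P hP0]
    have h5 : X ^ 2 ^ k = (↑V⁻¹ : 𝒜) * P * star (↑V⁻¹ : 𝒜) := by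
      have hs : star (V : 𝒜) * star (↑V⁻¹ : 𝒜) = 1 := by rw [← star_mul]; simp
      rw [hP, mul_assoc, mul_assoc _ (star (V : 𝒜)), hs, mul_one, Units.inv_mul_cancel_left]
    rw [← hX.isSelfAdjoint.norm_pow_two_pow, h5]
    refine (norm_mul_le _ _).trans ?_
    gcongr
    refine (norm_mul_le _ _).trans ?_
    gcongr
    rw [← h4]
    refine (norm_mul_le _ _).trans ?_
    gcongr
  obtain ⟨N, hN⟩ := pow_unbounded_of_one_lt
    (‖(↑V⁻¹ : 𝒜)‖ * (‖C‖ * ‖C‖) * ‖star (↑V⁻¹ : 𝒜)‖) hlt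
  exact (hN.trans_le ((pow_le_pow_right₀ hlt.le Nat.lt_two_pow_self.le).trans (hbound N))).false

end

/-! ### The nested bracket. -/

section
variable {H : Type*} [NormedAddCommGroup H] [InnerProductSpace ℂ H] [CompleteSpace H]
  {B : ℕ → H →L[ℂ] H} {t p : ℕ → ℝ}

theorem furutaNest_pos (hB : ∀ i, 1 ≤ i → IsStrictlyPositive (B i)) (t p : ℕ → ℝ) (m : ℕ) :
    IsStrictlyPositive (furutaNest B t p m) := by
  induction m using Nat.twoStepInduction with
  | zero => exact isStrictlyPositive_one
  | one => exact ((hB 2 (by omega)).rpow_conj ((hB 1 le_rfl).rpow _ _) _).rpow _ _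
  | more m _ ih =>
    exact ((hB _ (by omega)).rpow_conj (((hB _ (by omega)).rpow_conj ih _).rpow _ _) _).rpow _ _

theorem furutaNest_rpow_neg_one (hB : ∀ i, 1 ≤ i → IsStrictlyPositive (B i)) (t p : ℕ → ℝ)
    (m : ℕ) :
    furutaNest (fun i => B i ^ (-1 : ℝ)) t p m = furutaNest B t p m ^ (-1 : ℝ) := by
  induction m using Nat.twoStepInduction with
  | zero => simp [furutaNest]
  | one =>
    have h1 := hB 1 le_rfl
    have h2 := hB 2 (by omega)
    rw [furutaNest, furutaNest, (h2.rpow_conj (h1.rpow _ _) _).rpow_comm,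
      rpow_conj_rpow_neg_one h2 (h1.rpow _ _), h1.rpow_comm]
  | more m _ ih =>
    have h3 := hB (2 * m + 3) (by omega)
    have h4 := hB (2 * m + 4) (by omega)
    have hF := furutaNest_pos hB t p (m + 1)
    have hI := h3.rpow_conj hF (t (m + 1) / 2)
    rw [furutaNest, furutaNest, (h4.rpow_conj (hI.rpow _ _) _).rpow_comm,
      rpow_conj_rpow_neg_one h4 (hI.rpow _ _), hI.rpow_comm, rpow_conj_rpow_neg_one h3 hF, ih]

theorem furutaExpr_rpow_neg_one {C : H →L[ℂ] H} (hC : IsStrictlyPositive C)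
    (hB : ∀ i, 1 ≤ i → IsStrictlyPositive (B i)) (t p : ℕ → ℝ) (r : ℝ) (n : ℕ) :
    furutaExpr (C ^ (-1 : ℝ)) (fun i => B i ^ (-1 : ℝ)) t p r n =
      furutaExpr C B t p r n ^ (-1 : ℝ) := by
  have hF := furutaNest_pos hB t p n
  rw [furutaExpr, furutaExpr, (hC.rpow_conj hF _).rpow_comm, rpow_conj_rpow_neg_one hC hF,
    furutaNest_rpow_neg_one hB]

theorem furutaExpr_pos {C : H →L[ℂ] H} (hC : IsStrictlyPositive C)
    (hB : ∀ i, 1 ≤ i → IsStrictlyPositive (B i)) (t p : ℕ → ℝ) (r : ℝ) (n : ℕ) :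
    IsStrictlyPositive (furutaExpr C B t p r n) :=
  (hC.rpow_conj (furutaNest_pos hB t p n) _).rpow _ _

/-- Along an increasing chain, the nested bracket closed up at exponent `t m` is bounded by the
last operator used. -/
theorem furutaNest_bound (hB : ∀ i, 1 ≤ i → IsStrictlyPositive (B i))
    (hle : ∀ i, 1 ≤ i → B i ≤ B (i + 1)) {n : ℕ}
    (ht : ∀ i, 1 ≤ i → i ≤ n → 0 ≤ t i ∧ t i ≤ 1)
    (hp : ∀ j, 1 ≤ j → j ≤ 2 * n → 1 ≤ p j) (m : ℕ) (hm : m + 1 ≤ n) :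
    1 ≤ furutaPsi t p (m + 1) ∧
      (B (2 * m + 2) ^ (t (m + 1) / 2) * furutaNest B t p (m + 1) *
        B (2 * m + 2) ^ (t (m + 1) / 2)) ^ (1 / furutaPsi t p (m + 1)) ≤ B (2 * m + 2) := by
  induction m with
  | zero =>
    obtain ⟨ht0, ht1⟩ := ht 1 le_rfl hm
    have h1 := hp 1 le_rfl (by omega)
    have h2 := hp 2 (by omega) (by omega)
    refine ⟨?_, ?_⟩
    · simp only [furutaPsi]
      nlinarith
    · exact (grand_furuta (hB 1 le_rfl) (hle 1 le_rfl) ht0 ht1 h1 h2).trans (hle 1 le_rfl)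
  | succ m ih =>
    obtain ⟨hψ, hD⟩ := ih (by omega)
    obtain ⟨hs0, hs1⟩ := ht (m + 1) (by omega) (by omega)
    obtain ⟨ht0, ht1⟩ := ht (m + 2) (by omega) (by omega)
    have h3 := hp (2 * m + 3) (by omega) (by omega)
    have h4 := hp (2 * m + 4) (by omega) (by omega)
    have hF := furutaNest_pos hB t p (m + 1)
    have hB3 := hB (2 * m + 3) (by omega)
    have hψp : 1 ≤ furutaPsi t p (m + 1) * p (2 * m + 3) := by nlinarith
    have hI := hB3.rpow_conj hF (t (m + 1) / 2)
    have hE := rpow_conj_rpow_le_of_le (hB (2 * m + 2) (by omega)) (hle _ (by omega)) hF hs0 hs1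
      hψ hD
    have hE' := hE.trans (hle (2 * m + 3) (by omega))
    -- The base is a `ψ`-th root, so the power `ψ * p (2m+3)` restores the bracket raised to `p
    -- (2m+3)`.
    have hG := (grand_furuta (hI.rpow _ _) hE' ht0 ht1 hψp h4).trans hE'
    rw [hI.rpow_rpow, one_div, inv_mul_cancel_left₀ (by linarith)] at hG
    refine ⟨?_, hG⟩
    simp only [furutaPsi]
    nlinarith

theorem furutaExpr_le_of_chain (hB : ∀ i, 1 ≤ i → IsStrictlyPositive (B i))
    (hle : ∀ i, 1 ≤ i → B i ≤ B (i + 1)) {n : ℕ} (hn : 1 ≤ n)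
    (ht : ∀ i, 1 ≤ i → i ≤ n → 0 ≤ t i ∧ t i ≤ 1)
    (hp : ∀ j, 1 ≤ j → j ≤ 2 * n → 1 ≤ p j) {r : ℝ} (hr : t n ≤ r) :
    furutaExpr (B (2 * n)) B t p r n ≤ B (2 * n) ^ (r - t n) := by
  obtain ⟨m, rfl⟩ : ∃ m, n = m + 1 := ⟨n - 1, by omega⟩
  obtain ⟨hψ, hD⟩ := furutaNest_bound hB hle ht hp m le_rfl
  rw [show 2 * m + 2 = 2 * (m + 1) by ring] at hD
  have hC := hB (2 * (m + 1)) (by omega)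
  have hI := hC.rpow_conj (furutaNest_pos hB t p (m + 1)) (t (m + 1) / 2)
  -- Exponent `r - t` tops up the `t` already in the base to `r`.
  have h := furuta_chaotic (hI.rpow _ _) hD (r := r - t (m + 1)) (by linarith) hψ
  rwa [hI.rpow_rpow, one_div, inv_mul_cancel₀ (by linarith), rpow_one _ hI.nonneg,
    hC.rpow_conj_conj, sub_add_cancel, ← add_sub_assoc, add_sub_right_comm] at h

theorem furutaPsi_indicator (s : ℝ) (m : ℕ) :
    furutaPsi (fun i => if i = 1 then 1 else 0) (fun j => if j = 2 then s else 1) (m + 1) = 1 := by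
  induction m with
  | zero => simp [furutaPsi]
  | succ m ih => simp [furutaPsi, ih]

theorem furutaNest_indicator (hB : ∀ i, 1 ≤ i → IsStrictlyPositive (B i)) (m : ℕ) :
    ∃ S : H →L[ℂ] H, IsUnit S ∧ ∀ s : ℝ,
      furutaNest B (fun i => if i = 1 then 1 else 0) (fun j => if j = 2 then s else 1) (m + 1) =
        S * (B 2 ^ (-1 / 2 : ℝ) * B 1 * B 2 ^ (-1 / 2 : ℝ)) ^ s * star S := by
  induction m with
  | zero =>
    refine ⟨1, isUnit_one, fun s => ?_⟩
    simp [furutaNest, rpow_one _ (hB 1 le_rfl).nonneg]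
  | succ m ih =>
    obtain ⟨S, hS, h⟩ := ih
    have h3 := hB (2 * m + 3) (by omega)
    have h4 := hB (2 * m + 4) (by omega)
    refine ⟨B (2 * m + 3) ^ ((if m + 1 = 1 then (1 : ℝ) else 0) / 2) * S,
      (h3.rpow _ _).isUnit.mul hS, fun s => ?_⟩
    have hF := furutaNest_pos hB (fun i => if i = 1 then (1 : ℝ) else 0)
      (fun j => if j = 2 then s else 1) (m + 1)
    have hI := h3.rpow_conj hF ((if m + 1 = 1 then (1 : ℝ) else 0) / 2)
    simp only [furutaNest]
    rw [if_neg (by omega : ¬ 2 * m + 3 = 2), if_neg (by omega : ¬ 2 * m + 4 = 2),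
      if_neg (by omega : ¬ m + 2 = 1), rpow_one _ hI.nonneg, h4.rpow_zero_conj _ (by simp),
      rpow_one _ hI.nonneg, h s, star_mul, (rpow_nonneg (a := B (2 * m + 3))).isSelfAdjoint.star_eq]
    simp only [mul_assoc]

theorem le_of_forall_furutaExpr_le {C : H →L[ℂ] H} (hC : IsStrictlyPositive C)
    (hB : ∀ i, 1 ≤ i → IsStrictlyPositive (B i)) {n : ℕ} (hn : 1 ≤ n)
    (h : ∀ (t p : ℕ → ℝ) (r : ℝ), (∀ i, 1 ≤ i → i ≤ n → 0 ≤ t i ∧ t i ≤ 1) →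
      (∀ j, 1 ≤ j → j ≤ 2 * n → 1 ≤ p j) → t n ≤ r →
        furutaExpr C B t p r n ≤ C ^ (r - t n)) : B 1 ≤ B 2 := by
  obtain ⟨m, rfl⟩ : ∃ m, n = m + 1 := ⟨n - 1, by omega⟩
  obtain ⟨S, hS, hF⟩ := furutaNest_indicator hB m
  have h1 := hB 1 le_rfl
  have h2 := hB 2 (by omega)
  set X := B 2 ^ (-1 / 2 : ℝ) * B 1 * B 2 ^ (-1 / 2 : ℝ) with hX
  -- `τ` is the last `t`; since `ψ = 1`, the choice `r = 1 + τ` makes the outer exponent `1/2`.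
  obtain ⟨τ, hτ⟩ : ∃ τ : ℝ, τ = if m + 1 = 1 then (1 : ℝ) else 0 := ⟨_, rfl⟩
  have hX1 : X ≤ 1 := by
    refine le_one_of_rpow_conj_le (T := C ^ ((1 + τ) / 2) * S) (C := C)
      (h2.rpow_conj h1 _).nonneg ((hC.rpow _ _).isUnit.mul hS) fun s hs => ?_
    have := h (fun i => if i = 1 then 1 else 0) (fun j => if j = 2 then s else 1) (1 + τ)
      (fun i _ _ => by split_ifs <;> norm_num)
      (fun j _ _ => by split_ifs <;> linarith)
      (by simp only [← hτ]; linarith)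
    simp only [furutaExpr, furutaPsi_indicator, hF, ← hτ, add_sub_cancel_right,
      rpow_one C hC.nonneg] at this
    rw [star_mul, (rpow_nonneg (a := C)).isSelfAdjoint.star_eq]
    convert this using 2
    · simp only [mul_assoc]
    · ring
  have h5 := (h2.rpow_conj_le_iff (x := -1)).1 hX1
  rwa [neg_neg, mul_one, h2.rpow_mul_rpow, add_halves, rpow_one _ h2.nonneg] at h5

end

/-! ### The equivalence. -/

theorem theorem2p2 {H : Type*} [NormedAddCommGroup H] [InnerProductSpace ℂ H] [CompleteSpace H]
    (n : ℕ) (hn : 1 ≤ n) (A : ℕ → H →L[ℂ] H)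
    (hA : ∀ i, 1 ≤ i → i ≤ 2 * n → IsStrictlyPositive (A i)) :
    (∀ i, 1 ≤ i → i < 2 * n → A i ≤ A (i + 1)) ↔
      (∀ (t p : ℕ → ℝ) (r : ℝ),
        (∀ i, 1 ≤ i → i ≤ n → 0 ≤ t i ∧ t i ≤ 1) →
        (∀ j, 1 ≤ j → j ≤ 2 * n → 1 ≤ p j) →
        t n ≤ r →
          (∀ k, 1 ≤ k → k ≤ n →
            furutaExpr (A (2 * n)) (fun i => A (min (k + i - 1) (2 * n))) t p r n
              ≤ A (2 * n) ^ (r - t n)) ∧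
          (∀ k, n + 1 ≤ k → k ≤ 2 * n - 1 →
            A 1 ^ (r - t n)
              ≤ furutaExpr (A 1) (fun i => A (max (k + 2 - i) 1)) t p r n)) := by
  have hup (k : ℕ) (hk : 1 ≤ k) (i : ℕ) (hi : 1 ≤ i) :
      IsStrictlyPositive (A (min (k + i - 1) (2 * n))) := hA _ (by omega) (by omega)
  have hdown (k : ℕ) (hk : k ≤ 2 * n - 1) (i : ℕ) (hi : 1 ≤ i) :
      IsStrictlyPositive (A (max (k + 2 - i) 1)) := hA _ (by omega) (by omega)
  have hA1 := hA 1 le_rfl (by omega)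
  have hA2n := hA (2 * n) (by omega) le_rfl
  have hflip (k : ℕ) (hk : k ≤ 2 * n - 1) (t p : ℕ → ℝ) (r : ℝ) :
      A 1 ^ (r - t n) ≤ furutaExpr (A 1) (fun i => A (max (k + 2 - i) 1)) t p r n ↔
        furutaExpr (A 1 ^ (-1 : ℝ)) (fun i => A (max (k + 2 - i) 1) ^ (-1 : ℝ)) t p r n
          ≤ (A 1 ^ (-1 : ℝ)) ^ (r - t n) := by
    rw [furutaExpr_rpow_neg_one hA1 (hdown k hk), hA1.rpow_comm (-1),
      rpow_neg_one_le_rpow_neg_one_iff (hA1.rpow _ _) (furutaExpr_pos hA1 (hdown k hk) t p r n)]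
  constructor
  · intro hle t p r ht hp hr
    refine ⟨fun k hk1 hkn => ?_, fun k hk1 hk2 => (hflip k hk2 t p r).2 ?_⟩
    · have h := furutaExpr_le_of_chain (hup k hk1) (fun i hi => ?_) hn ht hp hr
      · rwa [min_eq_right (by omega : 2 * n ≤ k + 2 * n - 1)] at h
      · rcases lt_or_ge (k + i - 1) (2 * n) with hlt | hge
        · rw [min_eq_left hlt.le, min_eq_left (by omega),
            show k + (i + 1) - 1 = k + i - 1 + 1 by omega]
          exact hle _ (by omega) hlt
        · rw [min_eq_right hge, min_eq_right (by omega)]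
    · have h := furutaExpr_le_of_chain (fun i hi => (hdown k hk2 i hi).rpow _ (-1))
        (fun i hi => CStarAlgebra.rpow_neg_one_le_rpow_neg_one ?_ (hdown k hk2 _ (by omega)))
        hn ht hp hr
      · rwa [max_eq_right (by omega : k + 2 - 2 * n ≤ 1)] at h
      · rcases lt_or_ge i (k + 1) with hlt | hge
        · rw [max_eq_left (by omega), max_eq_left (by omega),
            show k + 2 - i = k + 2 - (i + 1) + 1 by omega]
          exact hle _ (by omega) (by omega)
        · rw [max_eq_right (by omega), max_eq_right (by omega)]
  · intro h k hk1 hk2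
    rcases le_or_gt k n with hkn | hkn
    · have h' := le_of_forall_furutaExpr_le hA2n (hup k hk1) hn
        fun t p r ht hp hr => (h t p r ht hp hr).1 k hk1 hkn
      rwa [min_eq_left (by omega), min_eq_left (by omega), Nat.add_sub_cancel,
        show k + 2 - 1 = k + 1 by omega] at h'
    · have hk : k ≤ 2 * n - 1 := by omega
      have h' := le_of_forall_furutaExpr_le (hA1.rpow _ (-1))
        (fun i hi => (hdown k hk i hi).rpow _ (-1)) hn
        fun t p r ht hp hr => (hflip k hk t p r).1 ((h t p r ht hp hr).2 k hkn hk)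
      -- Here `B₁ = A (k + 1)` and `B₂ = A k`; undoing the inversion restores the order.
      rw [rpow_neg_one_le_rpow_neg_one_iff (hdown k hk 2 (by omega)) (hdown k hk 1 le_rfl)] at h'
      rwa [max_eq_left (by omega), max_eq_left (by omega), Nat.add_sub_cancel,
        show k + 2 - 1 = k + 1 by omega] at h'
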